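/- Let $W = A_1 * \dots * A_n$ be a free product of nontrivial finite groups and let $\varphi \in \mathrm{Out}(W) = \mathrm{Aut}(W)/\mathrm{Inn}(W)$. A (marked) orbigraph is a finite graph of groups $G$ with an identification $\pi_1(G) = W$, such that $W$ acts on the universal covering tree $\tilde G$ without inversions, with finite vertex stabilizers and trivial edge stabilizers. The $0$-cells with nontrivial stabilizer are called cone points, the other $0$-cells vertices. A topological representative of $\varphi$ is an orbigraph homotopy equivalence $f\colon G \to G$ inducing $\varphi$ on $\pi_1(G) = W$, i.e. a map with a lift $\tilde f\colon \tilde G \to \tilde G$ satisfying $\tilde f(w x) = \Phi(w) \tilde f(x)$ for an automorphism $\Phi$ representing $\varphi$, that maps $0$-cells to $0$-cells, the set of cone points onto itself, and (the lift of) each edge to a nontrivial tight edge path. A subgraph $G_0 \subseteq G$ is invariant if $f(G_0) \subseteq G_0$, nontrivial if it contains an edge, and a forest if it is nontrivial and each of its components is contractible in the equivariant sense (i.e. is a tree with at most one cone point). A topological representative $f\colon G\to G$ is irreducible if $G$ has no nontrivial proper invariant subgraph. The outer automorphism $\varphi$ is irreducible if every topological representative $f\colon G \to G$ of $\varphi$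 for which $G$ has no valence-one vertices and no invariant forest is irreducible; otherwise $\varphi$ is reducible. That is, $\varphi$ is reducible if and only if it has a topological representative $f\colon G \to G$ such that $G$ has no valence-one vertices, has a nontrivial proper invariant subgraph, and has no invariant forest. Lemma. Let $k \ge 1$ and let $W^1, \dots, W^k$ be proper, infinite free factors of $W$ such that the subgroup they generate is their free product $W^1 * \dots * W^k$ and is a free factor of $W$. Suppose that $\varphi$ cyclically permutes the conjugacy classes of the $W^i$: for each $i$, $\varphi$ maps the conjugacy class of $W^i$ to that of $W^{i+1}$, indices mod $k$. Then $\varphi$ is reducible. -/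

import Mathlib

universe u

/-! ### Outer automorphisms -/

/-- The group `Inn(W)` of inner automorphisms, as a subgroup of `Aut(W)`. -/
def Inn (W : Type u) [Group W] : Subgroup (MulAut W) :=
  (MulAut.conj : W →* MulAut W).range

instance Inn.normal (W : Type u) [Group W] : (Inn W).Normal := by
  refine ⟨?_⟩
  rintro _ ⟨w, rfl⟩ Φ
  refine ⟨Φ w, ?_⟩
  ext x
  simp [MulAut.conj_apply]

/-- `Out(W) = Aut(W) / Inn(W)`. -/
abbrev Out (W : Type u) [Group W] : Type u := MulAut W ⧸ Inn W

/-- Two subgroups are conjugate. -/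
def SubgroupsConj {W : Type u} [Group W] (H K : Subgroup W) : Prop :=
  ∃ w : W, H.map (MulAut.conj w).toMonoidHom = K

/-- `φ` sends the conjugacy class of `H` to the conjugacy class of `K`: every (equivalently, some)
automorphism in the class `φ` sends `H` to a conjugate of `K`. -/
def Out.MapsConjClass {W : Type u} [Group W] (φ : Out W) (H K : Subgroup W) : Prop :=
  ∀ Φ : MulAut W, (Φ : Out W) = φ → SubgroupsConj (H.map Φ.toMonoidHom) K

/-! ### Free factors -/

/-- `H` is a free factor of `W`: there is a subgroup `K` with `W = H * K`, i.e. the natural map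
from the free product `H * K` to `W` is an isomorphism. -/
def IsFreeFactor {W : Type u} [Group W] (H : Subgroup W) : Prop :=
  ∃ K : Subgroup W, Function.Bijective (Monoid.Coprod.lift H.subtype K.subtype)

/-- The subgroup generated by the `H i` is their free product: the natural map from the abstract
free product of the `H i` to `W` is injective. Its image is then `⨆ i, H i`. -/
def GenerateFreeProduct {W : Type u} [Group W] {ι : Type*} (H : ι → Subgroup W) : Prop :=
  Function.Injective (Monoid.CoprodI.lift (fun i => (H i).subtype))

/-! ### Orbigraphs -/

/-- A (marked) `W`-orbigraph `G`: a finite graph of groups with fundamental group `W`, given by its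
universal cover, a tree, together with the action of `W` on it. The action is without inversions,
with finite vertex stabilizers (it is properly discontinuous), trivial edge stabilizers and finite
quotient graph. The orbigraph `G` itself is the quotient `W \ cover`; the marking is the given
identification of `W` with the group of deck transformations. All these trees are countable, so the
universe of `V` plays no role. -/
structure Orbigraph (W : Type u) [Group W] where
  /-- the `0`-cells of the universal cover -/
  V : Type u
  /-- the action of `W` on them -/
  [action : MulAction W V]
  /-- the universal cover -/
  cover : SimpleGraph V
  isTree : cover.IsTree
  smul_adj : ∀ (w : W) (x y : V), cover.Adj x y → cover.Adj (w • x) (w • y)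
  no_inversion : ∀ (w : W) (x y : V), cover.Adj x y → ¬ (w • x = y ∧ w • y = x)
  finite_stabilizer : ∀ x : V, Finite (MulAction.stabilizer W x)
  edge_stabilizer : ∀ (w : W) (x y : V), cover.Adj x y → w • x = x → w • y = y → w = 1
  finite_vertices : ∃ S : Set V, S.Finite ∧ ∀ x : V, ∃ w : W, w • x ∈ S
  finite_edges : ∃ S : Set (V × V), S.Finite ∧
    ∀ x y : V, cover.Adj x y → ∃ w : W, (w • x, w • y) ∈ S

namespace Orbigraph

variable {W : Type u} [Group W]

instance (G : Orbigraph W) : MulAction W G.V := G.action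

/-- The lifts to the universal cover of the cone points of `G`: `0`-cells with nontrivial
stabilizer. The remaining `0`-cells are the (lifts of) vertices. -/
def conePoints (G : Orbigraph W) : Set G.V :=
  {x | MulAction.stabilizer W x ≠ ⊥}

/-- `G` has no valence-one vertices. A vertex is a `0`-cell that is not a cone point; as its
stabilizer is trivial, its valence in `G` is the valence of any of its lifts to the cover. -/
def NoValenceOneVertex (G : Orbigraph W) : Prop :=
  ∀ x : G.V, x ∉ G.conePoints → (G.cover.neighborSet x).encard ≠ 1

/-- A subgraph of the orbigraph `G`, given by its full preimage in the universal cover, which is an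
arbitrary `W`-invariant subgraph. -/
structure Subgraph (G : Orbigraph W) where
  preimage : G.cover.Subgraph
  smul_verts : ∀ (w : W) (x : G.V), x ∈ preimage.verts → w • x ∈ preimage.verts
  smul_adj : ∀ (w : W) (x y : G.V), preimage.Adj x y → preimage.Adj (w • x) (w • y)

/-- A subgraph is nontrivial if it contains at least one edge. -/
def Subgraph.Nontrivial {G : Orbigraph W} (H : G.Subgraph) : Prop :=
  ∃ x y : G.V, H.preimage.Adj x y

/-- A subgraph is proper if it is not all of `G`. -/
def Subgraph.Proper {G : Orbigraph W} (H : G.Subgraph) : Prop :=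
  H.preimage ≠ ⊤

/-- `x` and `y` are in the same connected component of the preimage of `H`. -/
def Subgraph.SameComponent {G : Orbigraph W} (H : G.Subgraph) (x y : G.V) : Prop :=
  x ∈ H.preimage.verts ∧ y ∈ H.preimage.verts ∧ H.preimage.spanningCoe.Reachable x y

/-- The connected component of `H` onto which the component `C` of `x` in the preimage of `H`
projects is contractible, in the equivariant sense: `C` can be contracted to one of its points `c`
equivariantly with respect to the group of all `w : W` with `w C = C`. Since `C` is a tree, this
means that this group fixes `c`, and the straight-line homotopy to `c` is then an equivariant
contraction; as there are no inversions, `c` can be taken to be a `0`-cell. (Equivalently, the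
component of `H` is a tree with at most one cone point.) -/
def Subgraph.ComponentContractible {G : Orbigraph W} (H : G.Subgraph) (x : G.V) : Prop :=
  ∃ c : G.V, H.SameComponent x c ∧ ∀ w : W, H.SameComponent x (w • x) → w • c = c

/-- A forest is a nontrivial subgraph each of whose connected components is contractible. -/
def Subgraph.IsForest {G : Orbigraph W} (H : G.Subgraph) : Prop :=
  H.Nontrivial ∧ ∀ x ∈ H.preimage.verts, H.ComponentContractible x

/-! ### Topological representatives -/

/-- A topological representative `f : G → G` of `φ`, given by a lift to the universal cover. The
lift is equivariant with respect to an automorphism `Φ` of `W` in the class `φ` (this says that `f`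
is an orbigraph homotopy equivalence which induces `φ` on the fundamental group; replacing the lift
`f` by `w f` replaces `Φ` by `Φ` followed by conjugation by `w`). It sends `0`-cells to `0`-cells,
cone points onto cone points, and each edge `x y` of the cover to the (nontrivial) tight path from
`f x` to `f y`, which is unique because the cover is a tree. -/
structure TopRep (φ : Out W) (G : Orbigraph W) where
  Φ : MulAut W
  mk_eq : (Φ : Out W) = φ
  f : G.V → G.V
  equivariant : ∀ (w : W) (x : G.V), f (w • x) = Φ w • f x
  image_conePoints : f '' G.conePoints = G.conePoints
  nondegenerate : ∀ x y : G.V, G.cover.Adj x y → f x ≠ f y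

/-- `H` is `f`-invariant, `f(H) ⊆ H`: `0`-cells of `H` are mapped into `H`, and the tight path that
is the image of an edge of `H` consists of edges of `H`. -/
def TopRep.Invariant {φ : Out W} {G : Orbigraph W} (F : TopRep φ G) (H : G.Subgraph) : Prop :=
  (∀ x ∈ H.preimage.verts, F.f x ∈ H.preimage.verts) ∧
    ∀ x y : G.V, H.preimage.Adj x y →
      ∀ p : G.cover.Walk (F.f x) (F.f y), p.IsPath → ∀ e ∈ p.edges, e ∈ H.preimage.edgeSet

/-- A topological representative `f : G → G` is irreducible if `G` contains no nontrivial proper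
`f`-invariant subgraph. -/
def TopRep.IsIrreducible {φ : Out W} {G : Orbigraph W} (F : TopRep φ G) : Prop :=
  ¬ ∃ H : G.Subgraph, H.Nontrivial ∧ H.Proper ∧ F.Invariant H

/-- There is no `f`-invariant forest. -/
def TopRep.NoInvariantForest {φ : Out W} {G : Orbigraph W} (F : TopRep φ G) : Prop :=
  ¬ ∃ H : G.Subgraph, H.IsForest ∧ F.Invariant H

end Orbigraph

/-- `φ` is irreducible if every topological representative `f : G → G` of `φ` for which `G` has no
valence-one vertices and no invariant forests is irreducible. -/
def Out.IsIrreducible {W : Type u} [Group W] (φ : Out W) : Prop :=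
  ∀ (G : Orbigraph W) (F : G.TopRep φ),
    G.NoValenceOneVertex → F.NoInvariantForest → F.IsIrreducible

/-- `φ` is reducible if it is not irreducible. -/
def Out.IsReducible {W : Type u} [Group W] (φ : Out W) : Prop := ¬ φ.IsIrreducible

/-!
If all `0`-cells of an orbigraph are cone points, then it has no valence-one vertices, and it has no
forest at all: the stabilizers of the ends of an edge would have to fix a common vertex, but they
are nontrivial and each of them fixes nothing else. So it is enough to find a tree of this kind
together with an invariant proper subgraph that contains an edge.

The vertices of such a tree are the cosets of the factors of a decomposition of `W` into finite
groups, and an automorphism of `W` permutes these cosets in exactly one compatible way, because a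
finite subgroup of a free product fixes a coset of a factor
(`IsInternalFreeProduct.exists_fixed_coset`), which is unique unless the subgroup is trivial. The
edges can be chosen freely: every tree `D` on the index set of the factors gives a tree of cosets
(`IsInternalFreeProduct.isTree_cosetGraph`).

Suppose that each finite factor is contained in one of the `H j` or in the complement `K` of the
subgroup that they generate. Colour the finite factors accordingly, and choose `D` such that each
colour class is connected in `D`. The edges between factors contained in the same `H j` form a
subgraph whose components are the translates of the subtrees belonging to the `H j`. Since `φ`
permutes the conjugacy classes of the `H j`, these components are mapped to each other. The subgraph
contains an edge because `H j` is infinite, and it is proper because `H j ≠ ⊤`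
(`Out.isReducible_of_subproducts`).

It remains to find such a decomposition (`IsInternalFreeProduct.exists_refinement`). Each `A i` is
conjugate into a factor `P` of the free product of the `H j` and `K`, and the retraction
onto `P` restricts to `A i` as a conjugation. Replacing each `A i` by its image under this
retraction defines an endomorphism of `W`. Its image contains all the `H j` and `K`, so it is
surjective, hence an automorphism, because a free product of finitely many finite groups is
residually finite and therefore Hopfian (`Monoid.CoprodI.injective_of_surjective`). This takes the
place of the Kurosh subgroup theorem.
-/

open Monoid (CoprodI)

/-! ### Trees -/

theorem SimpleGraph.IsTree.exists_adj_dist_lt {V : Type*} {G : SimpleGraph V} (hG : G.IsTree)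
    {u v : V} (h : u ≠ v) : ∃ w, G.Adj u w ∧ G.dist w v < G.dist u v := by
  obtain ⟨p, hp⟩ := hG.connected.exists_walk_length_eq_dist u v
  cases p with
  | nil => exact absurd rfl h
  | cons hadj q =>
    refine ⟨_, hadj, ?_⟩
    have := SimpleGraph.dist_le q
    simp only [Walk.length_cons] at hp
    omega

/-- In a tree, a vertex has at most one neighbour that is not farther from `v` than itself. -/
theorem SimpleGraph.IsTree.eq_of_adj_of_dist_le {V : Type*} {G : SimpleGraph V} (hG : G.IsTree)
    {u v w w' : V} (h : G.Adj u w) (h' : G.Adj u w') (hd : G.dist w v ≤ G.dist u v)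
    (hd' : G.dist w' v ≤ G.dist u v) : w = w' := by
  have key : ∀ x, G.Adj u x → G.dist x v ≤ G.dist u v →
      ∃ p : G.Walk u v, p.IsPath ∧ p.snd = x := by
    intro x hx hxd
    obtain ⟨q, hq⟩ := hG.connected.exists_walk_length_eq_dist x v
    refine ⟨.cons hx q, ?_, by simp⟩
    apply SimpleGraph.Walk.isPath_of_length_eq_dist
    have := hG.dist_eq_dist_add_one_of_adj v hx
    rw [SimpleGraph.dist_comm (u := v), SimpleGraph.dist_comm (u := v)] at this
    simp only [Walk.length_cons]
    omega
  obtain ⟨p, hp, rfl⟩ := key w h hd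
  obtain ⟨p', hp', rfl⟩ := key w' h' hd'
  rw [(hG.existsUnique_path u v).unique hp hp']

/-- A criterion for being a tree: the vertices are ranked so that every vertex except the root `r`
has a neighbour of smaller rank, and no vertex has two neighbours of rank at most its own. The
highest vertex of a cycle would violate the second condition. -/
theorem SimpleGraph.isTree_of_rank {V α : Type*} [LinearOrder α] [WellFoundedLT α]
    (G : SimpleGraph V) (r : V) (rank : V → α)
    (hlower : ∀ v, v ≠ r → ∃ w, G.Adj v w ∧ rank w < rank v)
    (hunique : ∀ v w w', G.Adj v w → G.Adj v w' → rank w ≤ rank v → rank w' ≤ rank v → w = w') :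
    G.IsTree := by
  have hreach : ∀ a : α, ∀ v, rank v = a → G.Reachable v r := by
    intro a
    induction a using WellFoundedLT.induction with
    | ind a ih =>
      rintro v rfl
      by_cases hv : v = r
      · rw [hv]
      · obtain ⟨w, hadj, hlt⟩ := hlower v hv
        exact hadj.reachable.trans (ih _ hlt w rfl)
  have : Nonempty V := ⟨r⟩
  refine ⟨⟨fun v w => (hreach _ v rfl).trans (hreach _ w rfl).symm⟩, ?_⟩
  classical
  intro v c hc
  obtain ⟨m, hm, hmax⟩ := c.support.toFinset.exists_max_image rank ⟨v, by simp⟩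
  rw [List.mem_toFinset] at hm
  have hd : (c.rotate m hm).IsCycle := hc.rotate hm
  have hle : ∀ x ∈ (c.rotate m hm).support, rank x ≤ rank m := fun x hx =>
    hmax x (by simpa using hx)
  refine hd.snd_ne_penultimate (hunique m _ _ (Walk.adj_snd hd.not_nil)
    (Walk.adj_penultimate hd.not_nil).symm (hle _ ?_) (hle _ ?_))
  · exact Walk.getVert_mem_support _ _
  · exact Walk.getVert_mem_support _ _

section FixedPoint

variable {V : Type*} {G : SimpleGraph V} {F : Type*} [Group F] [MulAction F V]

theorem SimpleGraph.Connected.dist_smul_smul (hG : G.Connected)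
    (hadj : ∀ (g : F) (x y : V), G.Adj x y → G.Adj (g • x) (g • y)) (g : F) (x y : V) :
    G.dist (g • x) (g • y) = G.dist x y := by
  have hle : ∀ (g : F) x y, G.dist (g • x) (g • y) ≤ G.dist x y := by
    intro g x y
    obtain ⟨p, hp⟩ := hG.exists_walk_length_eq_dist x y
    rw [← hp, ← SimpleGraph.Walk.length_map (⟨(g • ·), hadj g _ _⟩ : G →g G) p]
    exact SimpleGraph.dist_le _
  refine le_antisymm (hle g x y) ?_
  simpa using hle g⁻¹ (g • x) (g • y)

/-- In a tree, moving away from `o` once along a shortest path means moving away from then on. -/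
theorem SimpleGraph.IsTree.dist_eq_of_dist_lt (hG : G.IsTree) {o c m c' : V} (h : G.Adj c m)
    (hm : G.dist m c' < G.dist c c') (ho : G.dist c o < G.dist m o) :
    G.dist c' o = G.dist c' m + G.dist m o := by
  induction hn : G.dist m c' generalizing c m with
  | zero =>
    obtain rfl := (hG.connected.dist_eq_zero_iff).1 hn
    simp
  | succ n ih =>
    have hne : m ≠ c' := by
      rintro rfl
      simp at hn
    obtain ⟨m', hadj, hlt⟩ := hG.exists_adj_dist_lt hne
    have hne' : m' ≠ c := by
      rintro rfl
      omega
    have hlt' : G.dist m o < G.dist m' o := by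
      by_contra hcon
      exact hne' (hG.eq_of_adj_of_dist_le hadj h.symm (not_lt.1 hcon) ho.le)
    have h1 := hG.dist_eq_dist_add_one_of_adj c' hadj
    have h2 := hG.dist_eq_dist_add_one_of_adj o hadj
    simp only [SimpleGraph.dist_comm (u := c'), SimpleGraph.dist_comm (u := o)] at h1 h2
    have := ih hadj hlt hlt' (by omega)
    rw [SimpleGraph.dist_comm (u := c') (v := m)]
    rw [SimpleGraph.dist_comm (u := c') (v := m')] at this
    omega

/-- A finite group acting on a tree without inversions fixes a vertex. A vertex `c` whose greatest
distance from a given orbit is as small as possible is fixed: two vertices of this kind are equal or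
adjacent, since otherwise the vertices strictly between them would be closer to the orbit, and a
tree contains no three pairwise adjacent vertices. -/
theorem SimpleGraph.IsTree.exists_fixed_vertex [Finite F] (hG : G.IsTree)
    (hadj : ∀ (g : F) (x y : V), G.Adj x y → G.Adj (g • x) (g • y))
    (hinv : ∀ (g : F) (x y : V), G.Adj x y → ¬(g • x = y ∧ g • y = x)) :
    ∃ x : V, ∀ g : F, g • x = x := by
  have := Fintype.ofFinite F
  obtain ⟨x₀⟩ := hG.connected.nonempty
  let ecc : V → ℕ := fun x => Finset.univ.sup fun g : F => G.dist x (g • x₀)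
  have hle : ∀ x (g : F), G.dist x (g • x₀) ≤ ecc x := fun x g =>
    Finset.le_sup (f := fun g : F => G.dist x (g • x₀)) (Finset.mem_univ g)
  obtain ⟨c, hc⟩ : ∃ c, ∀ x, ecc c ≤ ecc x := by
    obtain ⟨c, -, hc⟩ := WellFounded.has_min (measure ecc).wf Set.univ ⟨x₀, trivial⟩
    exact ⟨c, fun x => not_lt.1 (hc x trivial)⟩
  have hecc : ∀ (g : F), ecc (g • c) = ecc c := by
    have h1 : ∀ (g : F) x, ecc (g • x) ≤ ecc x := by
      intro g x
      refine Finset.sup_le fun h _ => ?_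
      have := hG.connected.dist_smul_smul hadj g x ((g⁻¹ * h) • x₀)
      rw [smul_smul, mul_inv_cancel_left] at this
      rw [this]
      exact hle _ _
    exact fun g => le_antisymm (h1 g c) (hc _)
  have hclose : ∀ g : F, g • c = c ∨ G.Adj c (g • c) := by
    intro g
    by_contra! hcon
    obtain ⟨m, hcm, hlt⟩ := hG.exists_adj_dist_lt hcon.1.symm
    have hmc : m ≠ g • c := fun h => hcon.2 (h ▸ hcm)
    have hpos := hG.connected.pos_dist_of_ne hmc.symm
    have hcase : ∀ h : F, G.dist m (h • x₀) < ecc c := by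
      intro h
      by_cases ho : G.dist c (h • x₀) < G.dist m (h • x₀)
      · have h1 := hG.dist_eq_of_dist_lt hcm hlt ho
        have h2 := hle (g • c) h
        rw [hecc] at h2
        omega
      · have h1 := hG.dist_eq_dist_add_one_of_adj (h • x₀) hcm
        simp only [SimpleGraph.dist_comm (u := h • x₀)] at h1
        have h2 := hle c h
        omega
    have hlt' : ecc m < ecc c := by
      refine (Finset.sup_lt_iff ?_).2 fun h _ => hcase h
      exact (Nat.zero_le _).trans_lt (hcase 1)
    exact absurd (hc m) (not_le.2 hlt')
  refine ⟨c, fun g => ?_⟩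
  by_contra hg
  have h1 : G.Adj c (g • c) := (hclose g).resolve_left hg
  have h2 : G.Adj (g • c) (g • g • c) := hadj g _ _ h1
  rcases hclose (g * g) with h3 | h3 <;> rw [mul_smul] at h3
  · exact hinv g c (g • c) h1 ⟨rfl, h3⟩
  · have := hG.dist_ne_of_adj c h2
    rw [SimpleGraph.dist_eq_one_iff_adj.2 h1, SimpleGraph.dist_eq_one_iff_adj.2 h3] at this
    exact this rfl

end FixedPoint

/-! ### Internal free products -/

section InternalFreeProduct

variable {W ι : Type*} [Group W] {B : ι → Subgroup W}

/-- `W` is the internal free product of the family of subgroups `B`. -/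
def IsInternalFreeProduct (B : ι → Subgroup W) : Prop :=
  Function.Bijective (CoprodI.lift fun i => (B i).subtype)

namespace IsInternalFreeProduct

/-- The isomorphism from the abstract free product of the factors. -/
noncomputable def equiv (hB : IsInternalFreeProduct B) : CoprodI (fun i => B i) ≃* W :=
  MulEquiv.ofBijective _ hB

theorem equiv_of (hB : IsInternalFreeProduct B) {i : ι} (b : B i) :
    hB.equiv (CoprodI.of (M := fun i => B i) b) = b :=
  CoprodI.lift_of (M := fun i => B i) (fun i => (B i).subtype) b

theorem equiv_symm_coe (hB : IsInternalFreeProduct B) {i : ι} (b : B i) :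
    hB.equiv.symm (b : W) = CoprodI.of (M := fun i => B i) b := by
  rw [MulEquiv.symm_apply_eq, equiv_of]

theorem induction_on (hB : IsInternalFreeProduct B) {p : W → Prop} (g : W) (one : p 1)
    (mem : ∀ i, ∀ b ∈ B i, p b) (mul : ∀ x y, p x → p y → p (x * y)) : p g := by
  obtain ⟨x, rfl⟩ := hB.equiv.surjective g
  induction x using CoprodI.induction_on with
  | one => simpa using one
  | of i b => rw [equiv_of]; exact mem i b b.2
  | mul x y hx hy => rw [map_mul]; exact mul _ _ hx hy

open Classical in
/-- The endomorphism that is the identity on the factors with index in `s` and kills the others: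
the retraction onto a subproduct. -/
noncomputable def proj (hB : IsInternalFreeProduct B) (s : Set ι) : W →* W :=
  (CoprodI.lift fun i => if i ∈ s then (B i).subtype else 1).comp hB.equiv.symm.toMonoidHom

theorem proj_of_mem (hB : IsInternalFreeProduct B) {s : Set ι} {i : ι} (hi : i ∈ s) {b : W}
    (hb : b ∈ B i) : hB.proj s b = b := by
  lift b to B i using hb
  simp [proj, equiv_symm_coe, hi]

theorem proj_of_notMem (hB : IsInternalFreeProduct B) {s : Set ι} {i : ι} (hi : i ∉ s) {b : W}
    (hb : b ∈ B i) : hB.proj s b = 1 := by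
  lift b to B i using hb
  simp [proj, equiv_symm_coe, hi]

theorem eq_one_of_mem (hB : IsInternalFreeProduct B) {i j : ι} (hij : i ≠ j) {b : W}
    (hi : b ∈ B i) (hj : b ∈ B j) : b = 1 := by
  rw [← hB.proj_of_mem (Set.mem_singleton i) hi]
  exact hB.proj_of_notMem (by simpa using hij.symm) hj

theorem proj_eq_self_of_mem_iSup (hB : IsInternalFreeProduct B) {s : Set ι} {g : W}
    (hg : g ∈ ⨆ i ∈ s, B i) : hB.proj s g = g := by
  have : (⨆ i ∈ s, B i) ≤ (hB.proj s).eqLocus (MonoidHom.id W) :=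
    iSup₂_le fun i hi b hb => hB.proj_of_mem hi hb
  exact this hg

theorem proj_mem_iSup (hB : IsInternalFreeProduct B) (s : Set ι) (g : W) :
    hB.proj s g ∈ ⨆ i ∈ s, B i := by
  induction g using hB.induction_on with
  | one => simp
  | mem i b hb =>
    by_cases hi : i ∈ s
    · rw [hB.proj_of_mem hi hb]
      exact le_iSup₂ (f := fun i (_ : i ∈ s) => B i) i hi hb
    · rw [hB.proj_of_notMem hi hb]
      exact one_mem _
  | mul x y hx hy => rw [map_mul]; exact mul_mem hx hy

/-! ### The tree of cosets of the factors of a free product -/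

open Classical in
/-- The reduced word of `g⁻¹`. The inverse makes the last letter of `g`, on which the coset of `g`
modulo a factor depends, the first letter of the word. -/
noncomputable def word (hB : IsInternalFreeProduct B) (g : W) : CoprodI.Word (fun i => B i) :=
  CoprodI.Word.equiv (hB.equiv.symm g⁻¹)

open Classical in
theorem word_mul (hB : IsInternalFreeProduct B) (g : W) {i : ι} (b : B i) :
    hB.word (g * b) = CoprodI.of (M := fun i => B i) b⁻¹ • hB.word g := by
  simp only [word, mul_inv_rev, map_mul, CoprodI.Word.equiv, Equiv.coe_fn_mk, mul_smul]
  rw [← hB.equiv_symm_coe]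
  simp

theorem word_one (hB : IsInternalFreeProduct B) : hB.word 1 = .empty := by
  classical
  simp [word, CoprodI.Word.equiv]

theorem word_injective (hB : IsInternalFreeProduct B) : Function.Injective hB.word := by
  classical
  intro x y h
  simpa [word] using h

open Classical in
/-- The reduced word of the inverse of the shortest element of the coset `g B j`. -/
noncomputable def tail (hB : IsInternalFreeProduct B) (j : ι) (g : W) :
    CoprodI.Word (fun i => B i) :=
  (CoprodI.Word.equivPair j (hB.word g)).tail

theorem tail_mul (hB : IsInternalFreeProduct B) {j : ι} (g : W) (b : B j) :
    hB.tail j (g * b) = hB.tail j g := by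
  classical
  rw [tail, hB.word_mul, CoprodI.Word.equivPair_smul_same]
  rfl

theorem tail_eq_word (hB : IsInternalFreeProduct B) {j : ι} {g : W}
    (h : (hB.word g).fstIdx ≠ some j) : hB.tail j g = hB.word g := by
  classical
  rw [tail, CoprodI.Word.equivPair_eq_of_fstIdx_ne h]

theorem length_tail_lt (hB : IsInternalFreeProduct B) {j : ι} {g : W}
    (h : (hB.word g).fstIdx = some j) :
    (hB.tail j g).toList.length < (hB.word g).toList.length := by
  classical
  rw [tail]
  generalize hB.word g = w at h
  cases w using CoprodI.Word.consRecOn with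
  | empty => simp [CoprodI.Word.fstIdx] at h
  | cons i m w h1 h2 =>
    simp only [CoprodI.Word.fstIdx_cons, Option.some.injEq] at h
    subst h
    rw [CoprodI.Word.cons_eq_smul, CoprodI.Word.equivPair_smul_same,
      CoprodI.Word.equivPair_eq_of_fstIdx_ne h1, ← CoprodI.Word.cons_eq_smul (h1 := h1) (h2 := h2)]
    simp

theorem word_mul_of_ne_one (hB : IsInternalFreeProduct B) {j : ι} {g : W}
    (h : (hB.word g).fstIdx ≠ some j) {b : B j} (hb : b ≠ 1) :
    (hB.word (g * b)).fstIdx = some j ∧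
      (hB.word (g * b)).toList.length = (hB.word g).toList.length + 1 := by
  classical
  rw [hB.word_mul, ← CoprodI.Word.cons_eq_smul (h1 := h) (h2 := by simpa using hb)]
  simp

theorem exists_reduced (hB : IsInternalFreeProduct B) (j : ι) (x : W ⧸ B j) :
    ∃ g : W, (g : W ⧸ B j) = x ∧ (hB.word g).fstIdx ≠ some j := by
  classical
  induction x using QuotientGroup.induction_on with
  | H g =>
    refine ⟨g * (CoprodI.Word.equivPair j (hB.word g)).head, by simp, ?_⟩
    rw [hB.word_mul, map_inv (CoprodI.of (M := fun i => B i)),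
      ← CoprodI.Word.equivPair_tail_eq_inv_smul]
    exact (CoprodI.Word.equivPair j (hB.word g)).fstIdx_ne

/-- The rank of the coset `g B j`: the length of its shortest element, and then the distance in `D`
from `j` to the index of the last letter of that element (to `r` if there is none). -/
noncomputable def rank (hB : IsInternalFreeProduct B) (D : SimpleGraph ι) (r : ι)
    (v : Σ i, W ⧸ B i) : ℕ ×ₗ ℕ :=
  Quotient.liftOn' v.2 (fun g => toLex ((hB.tail v.1 g).toList.length,
    D.dist v.1 ((hB.tail v.1 g).fstIdx.getD r))) (by
      intro g h hgh
      obtain ⟨b, rfl⟩ : ∃ b : B v.1, h = g * b :=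
        ⟨⟨_, QuotientGroup.leftRel_apply.1 hgh⟩, by simp⟩
      simp only [tail_mul])

theorem rank_mk (hB : IsInternalFreeProduct B) (D : SimpleGraph ι) (r j : ι) (g : W) :
    hB.rank D r ⟨j, g⟩ = toLex ((hB.tail j g).toList.length,
      D.dist j ((hB.tail j g).fstIdx.getD r)) := rfl

end IsInternalFreeProduct

/-- The graph whose vertices are the cosets of the subgroups `B i`, and in which `g B i` and `g B j`
are joined if `i` and `j` are joined in `D`. -/
def cosetGraph (D : SimpleGraph ι) (B : ι → Subgroup W) : SimpleGraph (Σ i, W ⧸ B i) where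
  Adj x y := D.Adj x.1 y.1 ∧ ∃ g : W, x = ⟨x.1, g⟩ ∧ y = ⟨y.1, g⟩
  symm := ⟨fun _ _ h => ⟨h.1.symm, h.2.imp fun _ h => h.symm⟩⟩
  loopless := ⟨fun x h => D.loopless.irrefl x.1 h.1⟩

theorem cosetGraph_adj_mk {D : SimpleGraph ι} {i j : ι} (h : D.Adj i j) (g : W) :
    (cosetGraph D B).Adj ⟨i, g⟩ ⟨j, g⟩ :=
  ⟨h, g, rfl, rfl⟩

theorem cosetGraph_smul_adj {D : SimpleGraph ι} (w : W) (x y : Σ i, W ⧸ B i)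
    (h : (cosetGraph D B).Adj x y) : (cosetGraph D B).Adj (w • x) (w • y) := by
  obtain ⟨i, x⟩ := x
  obtain ⟨j, y⟩ := y
  obtain ⟨hD, g, hx, hy⟩ := h
  rw [hx, hy]
  exact cosetGraph_adj_mk hD (w * g)

theorem cosetGraph_no_inversion {D : SimpleGraph ι} (w : W) (x y : Σ i, W ⧸ B i)
    (h : (cosetGraph D B).Adj x y) : ¬(w • x = y ∧ w • y = x) := by
  rintro ⟨rfl, -⟩
  exact D.loopless.irrefl x.1 h.1

/-- The graph of cosets of the factors of a free product, arranged along a tree, is a tree. -/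
theorem IsInternalFreeProduct.isTree_cosetGraph (hB : IsInternalFreeProduct B)
    {D : SimpleGraph ι} (hD : D.IsTree) : (cosetGraph D B).IsTree := by
  obtain ⟨r⟩ := hD.connected.nonempty
  refine SimpleGraph.isTree_of_rank _ ⟨r, (1 : W)⟩ (hB.rank D r) ?_ ?_
  · rintro ⟨j, x⟩ hv
    obtain ⟨g, rfl, hg⟩ := hB.exists_reduced j x
    have hl : j ≠ (hB.word g).fstIdx.getD r := by
      cases hw : (hB.word g).fstIdx with
      | some i =>
        rintro rfl
        exact hg hw
      | none =>
        rintro rfl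
        apply hv
        have : hB.word g = .empty := by
          apply CoprodI.Word.ext
          simpa [CoprodI.Word.fstIdx] using hw
        rw [← hB.word_one] at this
        rw [hB.word_injective this]
    obtain ⟨j', hadj, hlt⟩ := hD.exists_adj_dist_lt hl
    refine ⟨⟨j', g⟩, cosetGraph_adj_mk hadj g, ?_⟩
    rw [hB.rank_mk, hB.rank_mk, hB.tail_eq_word hg, Prod.Lex.toLex_lt_toLex]
    by_cases hj' : (hB.word g).fstIdx = some j'
    · exact Or.inl (hB.length_tail_lt hj')
    · rw [hB.tail_eq_word hj']
      exact Or.inr ⟨rfl, hlt⟩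
  · rintro ⟨j, x⟩
    obtain ⟨g, rfl, hg⟩ := hB.exists_reduced j x
    have key : ∀ u, (cosetGraph D B).Adj ⟨j, g⟩ u → hB.rank D r u ≤ hB.rank D r ⟨j, g⟩ →
        u = ⟨u.1, g⟩ ∧ D.dist u.1 ((hB.word g).fstIdx.getD r) ≤
          D.dist j ((hB.word g).fstIdx.getD r) := by
      rintro ⟨j', u⟩ ⟨hadj, h, h1, h2⟩ hle
      dsimp only at hadj h1 h2 ⊢
      obtain ⟨b, rfl⟩ : ∃ b : B j, h = g * b := by
        rw [Sigma.mk.injEq, heq_eq_eq] at h1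
        exact ⟨⟨_, QuotientGroup.eq.1 h1.2⟩, by simp⟩
      rw [h2, hB.rank_mk, hB.rank_mk, hB.tail_eq_word hg, Prod.Lex.toLex_le_toLex] at hle
      by_cases hb : b = 1
      · subst hb
        simp only [OneMemClass.coe_one, mul_one] at h2 hle
        refine ⟨h2, ?_⟩
        by_cases hj' : (hB.word g).fstIdx = some j'
        · simp [hj']
        · rw [hB.tail_eq_word hj'] at hle
          simpa using hle
      · obtain ⟨h3, h4⟩ := hB.word_mul_of_ne_one hg hb
        rw [hB.tail_eq_word (by rw [h3]; simpa using hadj.ne)] at hle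
        dsimp only at hle
        omega
    intro u u' hu hu' hle hle'
    obtain ⟨h1, h2⟩ := key u hu hle
    obtain ⟨h1', h2'⟩ := key u' hu' hle'
    rw [h1, h1', hD.eq_of_adj_of_dist_le hu.1 hu'.1 h2 h2']

theorem mem_stabilizer_coset {i : ι} {g w : W} :
    w • (⟨i, g⟩ : Σ i, W ⧸ B i) = ⟨i, g⟩ ↔ g⁻¹ * w * g ∈ B i := by
  rw [Sigma.smul_mk, Sigma.mk.injEq]
  simp only [heq_eq_eq, true_and]
  rw [MulAction.Quotient.smul_coe, smul_eq_mul, eq_comm, QuotientGroup.eq, mul_assoc]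

/-- Distinct vertices of the tree of cosets have stabilizers with trivial intersection. -/
theorem IsInternalFreeProduct.eq_of_smul_eq [Nonempty ι] (hB : IsInternalFreeProduct B)
    {w : W} (hw : w ≠ 1) {x y : Σ i, W ⧸ B i} (hx : w • x = x) (hy : w • y = y) : x = y := by
  obtain ⟨D, -, hD⟩ := (SimpleGraph.connected_top (V := ι)).exists_isTree_le
  have hT := hB.isTree_cosetGraph hD
  by_contra hne
  obtain ⟨z, hadj, hlt⟩ := hT.exists_adj_dist_lt hne
  have hz : w • z = z := by
    have hadj' := cosetGraph_smul_adj w _ _ hadj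
    rw [hx] at hadj'
    refine hT.eq_of_adj_of_dist_le hadj' hadj ?_ hlt.le (v := y)
    have := hT.connected.dist_smul_smul cosetGraph_smul_adj w z y
    rw [hy] at this
    exact this.trans_le hlt.le
  obtain ⟨hij, g, hxg, hzg⟩ := hadj
  rw [hxg, mem_stabilizer_coset] at hx
  rw [hzg, mem_stabilizer_coset] at hz
  have := hB.eq_one_of_mem hij.ne hx hz
  apply hw
  simpa [mul_assoc, mul_eq_one_iff_eq_inv, inv_mul_eq_iff_eq_mul] using this

/-- A finite subgroup of a free product fixes a coset of a factor: it is conjugate into a factor. -/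
theorem IsInternalFreeProduct.exists_fixed_coset [Nonempty ι] (hB : IsInternalFreeProduct B)
    (F : Subgroup W) [Finite F] : ∃ x : Σ i, W ⧸ B i, ∀ w ∈ F, w • x = x := by
  obtain ⟨D, -, hD⟩ := (SimpleGraph.connected_top (V := ι)).exists_isTree_le
  obtain ⟨x, hx⟩ := (hB.isTree_cosetGraph hD).exists_fixed_vertex (F := F)
    (fun g => cosetGraph_smul_adj (g : W)) (fun g => cosetGraph_no_inversion (g : W))
  exact ⟨x, fun w hw => hx ⟨w, hw⟩⟩

end InternalFreeProduct

/-! ### Free products of finite groups are Hopfian -/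

section Hopfian

variable {ι : Type*} {A : ι → Type*} [∀ i, Group (A i)]

open Classical in
/-- The action of a group on `Y`, modified to be trivial on the orbits not contained in `X`. -/
noncomputable def truncatedAction (M : Type*) {Y : Type*} [Group M] [MulAction M Y] (X : Set Y) :
    M →* Equiv.Perm Y :=
  letI : MulAction M Y :=
    { smul := fun a y => if MulAction.orbit M y ⊆ X then a • y else y
      one_smul := fun y => by
        change (if _ then (1 : M) • y else y) = y
        simp
      mul_smul := fun a b y => by
        change (if _ then (a * b) • y else y) =
          if MulAction.orbit M (if MulAction.orbit M y ⊆ X then b • y else y) ⊆ X then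
            a • (if MulAction.orbit M y ⊆ X then b • y else y)
          else (if MulAction.orbit M y ⊆ X then b • y else y)
        by_cases h : MulAction.orbit M y ⊆ X
        · simp [h, MulAction.orbit_smul, mul_smul]
        · simp [h] }
  MulAction.toPermHom M Y

theorem truncatedAction_apply_of_subset {M Y : Type*} [Group M] [MulAction M Y] {X : Set Y} {y : Y}
    (h : MulAction.orbit M y ⊆ X) (a : M) : truncatedAction M X a y = a • y :=
  if_pos h

theorem truncatedAction_apply_of_notMem {M Y : Type*} [Group M] [MulAction M Y] {X : Set Y} {y : Y}
    (h : y ∉ X) (a : M) : truncatedAction M X a y = y :=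
  if_neg fun h' => h (h' (MulAction.mem_orbit_self y))

theorem finite_fixingSubgroup_compl {Y : Type*} {X : Set Y} (hX : X.Finite) :
    Finite (fixingSubgroup (Equiv.Perm Y) Xᶜ) := by
  classical
  have := hX.to_subtype
  refine Finite.of_injective (β := Equiv.Perm X)
    (fun σ => (σ : Equiv.Perm Y).subtypePerm (p := (· ∈ X)) fun y => ?_) ?_
  · have hfix : ∀ y ∉ X, (σ : Equiv.Perm Y) y = y := fun y hy =>
      (mem_fixingSubgroup_iff _).1 σ.2 y hy
    refine not_iff_not.1 ⟨fun h => ?_, fun h => ?_⟩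
    · have := hfix _ h
      rwa [(σ : Equiv.Perm Y).injective this] at h
    · rwa [hfix y h]
  · intro σ τ h
    ext y
    by_cases hy : y ∈ X
    · simpa using congrArg Subtype.val (Equiv.ext_iff.1 h ⟨y, hy⟩)
    · rw [← Equiv.Perm.smul_def, ← Equiv.Perm.smul_def, (mem_fixingSubgroup_iff _).1 σ.2 y hy,
        (mem_fixingSubgroup_iff _).1 τ.2 y hy]

/-- A free product of finite groups is residually finite: the factors act on the set of reduced
words by left multiplication; truncating these actions to a finite set of words that contains all
the suffixes of `g` and their translates by the factors gives a finite permutation group in which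
`g` still moves the empty word. -/
theorem Monoid.CoprodI.exists_hom_finite_ne_one [∀ i, Finite (A i)] {g : CoprodI A} (hg : g ≠ 1) :
    ∃ (Q : Subgroup (Equiv.Perm (CoprodI.Word A))) (ρ : CoprodI A →* Q), Finite Q ∧ ρ g ≠ 1 := by
  classical
  let ρ (X : Set (CoprodI.Word A)) : CoprodI A →* Equiv.Perm (CoprodI.Word A) :=
    CoprodI.lift fun i => truncatedAction (A i) X
  have hsuff : ∀ w : CoprodI.Word A, ∃ X₀ : Set (CoprodI.Word A), X₀.Finite ∧
      ∀ X, X₀ ⊆ X → ρ X w.prod .empty = w := by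
    intro w
    induction w using CoprodI.Word.consRecOn with
    | empty => exact ⟨∅, Set.finite_empty, fun X _ => by simp⟩
    | cons i a w h1 h2 ih =>
      obtain ⟨X₀, hfin, hX₀⟩ := ih
      refine ⟨X₀ ∪ MulAction.orbit (A i) w, hfin.union (Set.finite_range _), fun X hX => ?_⟩
      rw [Set.union_subset_iff] at hX
      rw [CoprodI.Word.prod_cons, map_mul, Equiv.Perm.mul_apply, hX₀ X hX.1, CoprodI.lift_of,
        truncatedAction_apply_of_subset hX.2, CoprodI.Word.smul_eq_of_smul,
        CoprodI.Word.cons_eq_smul]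
  obtain ⟨w, rfl⟩ := CoprodI.Word.equiv.symm.surjective g
  change w.prod ≠ 1 at hg
  change ∃ (Q : Subgroup (Equiv.Perm (CoprodI.Word A))) (ρ : CoprodI A →* Q),
    Finite Q ∧ ρ w.prod ≠ 1
  obtain ⟨X, hfin, hX⟩ := hsuff w
  have hrange : ∀ g, ρ X g ∈ fixingSubgroup (Equiv.Perm (CoprodI.Word A)) Xᶜ := by
    intro g
    have : (ρ X).range ≤ fixingSubgroup (Equiv.Perm (CoprodI.Word A)) Xᶜ := by
      refine CoprodI.lift_range_le _ _ fun i => ?_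
      rintro _ ⟨a, rfl⟩
      exact (mem_fixingSubgroup_iff _).2 fun y hy => truncatedAction_apply_of_notMem hy a
    exact this ⟨g, rfl⟩
  refine ⟨_, (ρ X).codRestrict _ hrange, finite_fixingSubgroup_compl hfin, fun h => hg ?_⟩
  have h1 : ρ X w.prod = 1 := congrArg Subtype.val h
  have h2 := hX X subset_rfl
  rw [h1, Equiv.Perm.one_apply] at h2
  rw [← h2, CoprodI.Word.prod_empty]

/-- A free product of finitely many finite groups is Hopfian: it has only finitely many
homomorphisms to each finite group, so precomposition with a surjective endomorphism permutes them,
and they separate points. -/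
theorem Monoid.CoprodI.injective_of_surjective [Finite ι] [∀ i, Finite (A i)]
    (θ : CoprodI A →* CoprodI A) (hθ : Function.Surjective θ) : Function.Injective θ := by
  rw [injective_iff_map_eq_one]
  intro g hg
  by_contra hne
  obtain ⟨Q, ρ, hQ, hρ⟩ := exists_hom_finite_ne_one hne
  have : Finite (CoprodI A →* Q) :=
    have : ∀ i, Finite (A i →* Q) := fun i => DFunLike.finite _
    Finite.of_equiv _ CoprodI.lift
  have hinj : Function.Injective fun σ : CoprodI A →* Q => σ.comp θ := fun σ τ h =>
    (MonoidHom.cancel_right hθ).1 h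
  obtain ⟨σ, rfl⟩ := Finite.surjective_of_injective hinj ρ
  exact hρ (by simp [hg])

end Hopfian

/-! ### Refining a free product decomposition -/

section AdaptedDecomposition

variable {ι κ : Type*} {A : ι → Type*} [∀ i, Group (A i)] [∀ i, Finite (A i)] [Finite ι]

/-- Given two decompositions of a group as a free product, the first of them into finitely many
finite groups, the first can be chosen to refine the second. A finite factor `A i` of the first is
conjugate into a factor `P (c i)` of the second. The retraction to `P (c i)` restricts to `A i` as
conjugation by some element, and these restrictions together define an endomorphism, which is
surjective and hence an automorphism. It moves the first decomposition to one that refines the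
second. -/
theorem IsInternalFreeProduct.exists_refinement [Nonempty κ] {P : κ → Subgroup (CoprodI A)}
    (hP : IsInternalFreeProduct P) :
    ∃ (c : ι → κ) (B : ι → Subgroup (CoprodI A)), IsInternalFreeProduct B ∧
      (∀ i, Nonempty (A i ≃* B i)) ∧ ∀ j, P j = ⨆ i ∈ c ⁻¹' {j}, B i := by
  have hfix : ∀ i, ∃ x : Σ j, CoprodI A ⧸ P j,
      ∀ w ∈ (CoprodI.of : A i →* CoprodI A).range, w • x = x := fun i =>
    have : Finite (CoprodI.of : A i →* CoprodI A).range := Set.finite_range _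
    hP.exists_fixed_coset _
  choose x hx using hfix
  let c : ι → κ := fun i => (x i).1
  have hconj : ∀ i, ∃ g : CoprodI A, ∀ a : A i, g⁻¹ * CoprodI.of a * g ∈ P (c i) := by
    intro i
    obtain ⟨g, hg⟩ := QuotientGroup.mk_surjective (x i).2
    refine ⟨g, fun a => mem_stabilizer_coset.1 ?_⟩
    have := hx i (CoprodI.of a) ⟨a, rfl⟩
    rwa [show x i = ⟨c i, g⟩ by rw [hg]] at this
  let θ : CoprodI A →* CoprodI A :=
    CoprodI.lift fun i => (hP.proj {c i}).comp CoprodI.of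
  have hθ : ∀ i (a : A i), θ (CoprodI.of a) = hP.proj {c i} (CoprodI.of a) := fun i a => by
    simp [θ]
  let B : ι → Subgroup (CoprodI A) := fun i => (θ.comp (CoprodI.of : A i →* CoprodI A)).range
  have hB_le : ∀ i, B i ≤ P (c i) := by
    rintro i _ ⟨a, rfl⟩
    rw [MonoidHom.comp_apply, hθ]
    simpa using hP.proj_mem_iSup {c i} (CoprodI.of a)
  have hPB : ∀ j, P j = ⨆ i ∈ c ⁻¹' {j}, B i := by
    intro j
    refine le_antisymm (fun p hp => ?_) (iSup₂_le fun i hi => ?_)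
    · rw [← hP.proj_of_mem (Set.mem_singleton j) hp]
      generalize p = w
      induction w using CoprodI.induction_on with
      | one => simp
      | of i a =>
        by_cases hi : c i = j
        · subst hi
          rw [← hθ]
          exact le_iSup₂ (f := fun i' (_ : i' ∈ c ⁻¹' {c i}) => B i') i rfl ⟨a, rfl⟩
        · -- The retraction to `P j` kills the conjugates of the other factors.
          obtain ⟨g, hg⟩ := hconj i
          have := hP.proj_of_notMem (s := {j}) hi (hg a)
          rw [map_mul, map_mul, map_inv] at this
          have : hP.proj {j} (CoprodI.of a) = 1 := by
            simpa [mul_assoc, inv_mul_eq_iff_eq_mul] using this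
          rw [this]
          exact one_mem _
      | mul x y hx hy => rw [map_mul]; exact mul_mem hx hy
    · rw [← show c i = j from hi]
      exact hB_le i
  have hsurj : Function.Surjective θ := by
    intro w
    change w ∈ θ.range
    induction w using hP.induction_on with
    | one => exact one_mem _
    | mul x y hx hy => exact mul_mem hx hy
    | mem j p hp =>
      rw [hPB] at hp
      have : (⨆ i ∈ c ⁻¹' {j}, B i) ≤ θ.range := by
        refine iSup₂_le fun i _ => ?_
        rintro _ ⟨a, rfl⟩
        exact ⟨CoprodI.of a, rfl⟩
      exact this hp
  have hinj := CoprodI.injective_of_surjective θ hsurj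
  have hinj_of : ∀ i, Function.Injective (θ.comp (CoprodI.of : A i →* CoprodI A)) := fun i =>
    hinj.comp (CoprodI.of_injective i)
  let e : ∀ i, A i ≃* B i := fun i => MonoidHom.ofInjective (hinj_of i)
  refine ⟨c, B, ?_, fun i => ⟨e i⟩, hPB⟩
  -- `θ` factors through the free product of the `B i`.
  let E : CoprodI A →* CoprodI (fun i => B i) :=
    CoprodI.lift fun i => (CoprodI.of (M := fun i => B i)).comp (e i).toMonoidHom
  have hE : (CoprodI.lift fun i => (B i).subtype).comp E = θ := by
    refine CoprodI.ext_hom _ _ fun i => MonoidHom.ext fun a => ?_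
    simp only [E, e, MonoidHom.comp_apply, CoprodI.lift_of]
    rfl
  have hEsurj : Function.Surjective E := by
    intro y
    change y ∈ E.range
    induction y using CoprodI.induction_on with
    | one => exact one_mem _
    | mul x y hx hy => exact mul_mem hx hy
    | of i b =>
      obtain ⟨a, rfl⟩ := (e i).surjective b
      exact ⟨CoprodI.of a, by simp [E]⟩
  rw [← hE] at hinj hsurj
  refine ⟨fun y y' h => ?_, Function.Surjective.of_comp (g := E) hsurj⟩
  obtain ⟨z, rfl⟩ := hEsurj y
  obtain ⟨z', rfl⟩ := hEsurj y'
  rw [hinj h]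

end AdaptedDecomposition

/-! ### Trees on coloured sets -/

/-- The elements of a nonempty coloured set can be arranged in a tree in which every element `i` is
equal or adjacent to a representative `b i` of its colour class: the classes are made into
stars, and the star of `b i₀ = i₀` is joined to the others at their centres. -/
theorem exists_isTree_star_fibers {ι κ : Type*} [Nonempty ι] (c : ι → κ) :
    ∃ (D : SimpleGraph ι) (b : ι → ι), D.IsTree ∧ (∀ i, c (b i) = c i) ∧
      (∀ i j, c i = c j → b i = b j) ∧ ∀ i, b i ≠ i → D.Adj i (b i) := by
  classical
  obtain ⟨i₀⟩ := ‹Nonempty ι›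
  let s : κ → ι := fun k => if k = c i₀ then i₀ else Function.invFun c k
  have hs : ∀ i, c (s (c i)) = c i := by
    intro i
    by_cases h : c i = c i₀
    · simp [s, h]
    · simp only [s, h, if_false]
      exact Function.invFun_eq ⟨i, rfl⟩
  have hs₀ : s (c i₀) = i₀ := if_pos rfl
  let par : ι → ι := fun i => if s (c i) = i then i₀ else s (c i)
  let rank : ι → ℕ := fun i => if i = i₀ then 0 else if s (c i) = i then 1 else 2
  have hpar₀ : par i₀ = i₀ := if_pos hs₀
  have hrank : ∀ i, i ≠ i₀ → rank (par i) < rank i := by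
    intro i hi
    by_cases h : s (c i) = i
    · simp [par, rank, h, hi]
    · simp only [par, rank, h, hi, hs, if_true, if_false]
      split_ifs <;> omega
  let D : SimpleGraph ι :=
    { Adj := fun i j => i ≠ j ∧ (par i = j ∨ par j = i)
      symm := ⟨fun _ _ h => ⟨h.1.symm, h.2.symm⟩⟩
      loopless := ⟨fun _ h => h.1 rfl⟩ }
  have hadj : ∀ i, i ≠ i₀ → D.Adj i (par i) := by
    refine fun i hi => ⟨fun h => ?_, Or.inl rfl⟩
    have := hrank i hi
    rw [← h] at this
    exact this.false
  have hlow : ∀ i j, D.Adj i j → rank j ≤ rank i → j = par i := by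
    rintro i j ⟨hne, h | h⟩ hle
    · exact h.symm
    · have hj : j ≠ i₀ := by
        rintro rfl
        exact hne (h.symm.trans hpar₀)
      have := hrank j hj
      rw [h] at this
      omega
  refine ⟨D, fun i => s (c i), D.isTree_of_rank i₀ rank (fun i hi => ⟨_, hadj i hi, hrank i hi⟩)
    fun v w w' h h' hle hle' => (hlow v w h hle).trans (hlow v w' h' hle').symm, hs,
    fun i j h => congrArg s h, fun i hi => ?_⟩
  have := hadj i (by rintro rfl; exact hi hs₀)
  rwa [show par i = s (c i) from if_neg hi] at this

/-! ### Orbigraphs whose `0`-cells are cone points -/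

section CosetOrbigraph

variable {W : Type u} [Group W] {ι : Type} {B : ι → Subgroup W}

theorem finite_stabilizer_coset (hfin : ∀ i, Finite (B i)) (x : Σ i, W ⧸ B i) :
    Finite (MulAction.stabilizer W x) := by
  obtain ⟨i, x⟩ := x
  induction x using QuotientGroup.induction_on with
  | H g =>
    have := hfin i
    refine Finite.of_injective (β := B i)
      (fun w => ⟨g⁻¹ * w * g, mem_stabilizer_coset.1 w.2⟩) fun w w' h => ?_
    simpa using congrArg Subtype.val h

theorem exists_ne_one_smul_eq (hnt : ∀ i, Nontrivial (B i)) (x : Σ i, W ⧸ B i) :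
    ∃ w : W, w ≠ 1 ∧ w • x = x := by
  obtain ⟨i, x⟩ := x
  induction x using QuotientGroup.induction_on with
  | H g =>
    have := hnt i
    obtain ⟨b, hb⟩ := exists_ne (1 : B i)
    refine ⟨g * b * g⁻¹, by simpa using hb, mem_stabilizer_coset.2 ?_⟩
    simp [mul_assoc]

/-- The orbigraph whose `0`-cells are cone points with groups `B i`, joined along the edges of a
tree `D`. -/
def cosetOrbigraph [Finite ι] (hB : IsInternalFreeProduct B) (hfin : ∀ i, Finite (B i))
    {D : SimpleGraph ι} (hD : D.IsTree) : Orbigraph W where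
  V := Σ i, W ⧸ B i
  cover := cosetGraph D B
  isTree := hB.isTree_cosetGraph hD
  smul_adj := cosetGraph_smul_adj
  no_inversion := cosetGraph_no_inversion
  finite_stabilizer := finite_stabilizer_coset hfin
  edge_stabilizer w x y hadj hx hy := by
    have : Nonempty ι := hD.connected.nonempty
    by_contra hw
    exact hadj.ne (hB.eq_of_smul_eq hw hx hy)
  finite_vertices := by
    refine ⟨Set.range fun i => ⟨i, (1 : W)⟩, Set.finite_range _, ?_⟩
    rintro ⟨i, x⟩
    induction x using QuotientGroup.induction_on with
    | H g => exact ⟨g⁻¹, i, by simp [Sigma.smul_mk]⟩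
  finite_edges := by
    refine ⟨Set.range fun p : ι × ι => (⟨p.1, (1 : W)⟩, ⟨p.2, (1 : W)⟩), Set.finite_range _, ?_⟩
    rintro ⟨i, x⟩ ⟨j, y⟩ ⟨-, g, hx, hy⟩
    dsimp only at hx hy
    refine ⟨g⁻¹, (i, j), ?_⟩
    rw [hx, hy]
    simp [Sigma.smul_mk]

/-- Every automorphism of a free product of nontrivial finite groups is realized by a bijection of
the set of cosets of the factors, because these cosets correspond to the maximal finite
subgroups. -/
theorem IsInternalFreeProduct.exists_equivariant_bijective [Nonempty ι]
    (hB : IsInternalFreeProduct B) (hfin : ∀ i, Finite (B i)) (hnt : ∀ i, Nontrivial (B i))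
    (Φ : MulAut W) : ∃ f : (Σ i, W ⧸ B i) → Σ i, W ⧸ B i, Function.Bijective f ∧
      ∀ (w : W) x, f (w • x) = Φ w • f x := by
  have hex : ∀ (Φ : MulAut W) (x : Σ i, W ⧸ B i), ∃ y : Σ i, W ⧸ B i,
      ∀ w : W, w • x = x → Φ w • y = y := by
    intro Φ x
    have := finite_stabilizer_coset hfin x
    have : Finite ((MulAction.stabilizer W x).map Φ.toMonoidHom) :=
      Set.Finite.image Φ (Set.toFinite (MulAction.stabilizer W x : Set W))
    obtain ⟨y, hy⟩ := hB.exists_fixed_coset ((MulAction.stabilizer W x).map Φ.toMonoidHom)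
    exact ⟨y, fun w hw => hy _ ⟨w, hw, rfl⟩⟩
  have huniq : ∀ (Φ : MulAut W) (x y z : Σ i, W ⧸ B i), (∀ w : W, w • x = x → Φ w • y = y) →
      (∀ w : W, w • x = x → Φ w • z = z) → y = z := by
    intro Φ x y z hy hz
    obtain ⟨w, hw, hwx⟩ := exists_ne_one_smul_eq hnt x
    exact hB.eq_of_smul_eq (by simpa using hw) (hy w hwx) (hz w hwx)
  have hinv : ∀ (Φ Ψ : MulAut W) (f f' : (Σ i, W ⧸ B i) → Σ i, W ⧸ B i),
      (∀ x (w : W), w • x = x → Φ w • f x = f x) →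
      (∀ x (w : W), w • x = x → Ψ w • f' x = f' x) → (∀ w, Ψ (Φ w) = w) →
      Function.LeftInverse f' f := by
    intro Φ Ψ f f' hf hf' h x
    refine huniq 1 x _ _ (fun w hw => ?_) fun w hw => hw
    have := hf' _ _ (hf x w hw)
    rwa [h] at this
  choose f hf using hex Φ
  choose f' hf' using hex Φ⁻¹
  refine ⟨f, ⟨(hinv _ _ _ _ hf hf' fun w => by simp).injective,
    (hinv _ _ _ _ hf' hf fun w => by simp).surjective⟩, fun w x => ?_⟩
  refine huniq Φ (w • x) _ _ (hf _) fun v hv => ?_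
  have := hf x (w⁻¹ * v * w) (by rw [mul_smul, mul_smul, hv, inv_smul_smul])
  rw [map_mul, map_mul, map_inv, mul_smul, mul_smul, inv_smul_eq_iff] at this
  exact this

end CosetOrbigraph

/-! ### Invariant subgraphs from subproducts -/

section Reducible

variable {W : Type u} [Group W] {ι κ : Type} {B : ι → Subgroup W}

/-- Any two vertices of the subtree of the cosets `g p B i`, where `p` lies in the subproduct `P` of
the factors of a fixed colour and `i` has that colour, are connected within any graph `M` that
connects any two factors of that colour. -/
theorem reachable_of_mem_iSup {M : SimpleGraph (Σ i, W ⧸ B i)} {s : Set ι}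
    (hM : ∀ (g : W), ∀ i ∈ s, ∀ j ∈ s, M.Reachable ⟨i, g⟩ ⟨j, g⟩) {p : W} (hp : p ∈ ⨆ i ∈ s, B i)
    (g : W) {i j : ι} (hi : i ∈ s) (hj : j ∈ s) : M.Reachable ⟨i, g⟩ ⟨j, (g * p : W)⟩ := by
  let S : Subgroup W :=
    { carrier := {p | ∀ (g : W), ∀ i ∈ s, ∀ j ∈ s, M.Reachable ⟨i, g⟩ ⟨j, (g * p : W)⟩}
      one_mem' := by simpa using hM
      mul_mem' := fun {p q} hp hq g i hi j hj => by
        rw [← mul_assoc]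
        exact (hp g i hi j hj).trans (hq (g * p) j hj j hj)
      inv_mem' := fun {p} hp g i hi j hj => by
        simpa using (hp (g * p⁻¹) j hj i hi).symm }
  have hS : ⨆ i ∈ s, B i ≤ S := by
    refine iSup₂_le fun i' hi' b hb g i hi j hj => (hM g i hi i' hi').trans ?_
    have : (g : W ⧸ B i') = (g * b : W) := QuotientGroup.eq.2 (by simpa using hb)
    rw [this]
    exact hM (g * b) i' hi' j hj
  exact hS hp g i hi j hj

/-- An equivariant map of the tree of cosets maps the subtree of a subproduct into a translate of
the subtree of any subproduct to which the automorphism maps it. -/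
theorem IsInternalFreeProduct.exists_image_eq [Nonempty ι] (hB : IsInternalFreeProduct B)
    (hnt : ∀ i, Nontrivial (B i)) {Φ : MulAut W} {f : (Σ i, W ⧸ B i) → Σ i, W ⧸ B i}
    (hf : ∀ (w : W) x, f (w • x) = Φ w • f x) {s t : Set ι} {w : W}
    (hw : ∀ p ∈ ⨆ i ∈ s, B i, w * Φ p * w⁻¹ ∈ ⨆ i ∈ t, B i) {i : ι} (hi : i ∈ s) (g : W) :
    ∃ i' ∈ t, ∃ p ∈ ⨆ i ∈ t, B i, f ⟨i, g⟩ = ⟨i', (Φ g * w⁻¹ * p : W)⟩ := by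
  obtain ⟨b, hb⟩ := exists_ne (1 : B i)
  have hbfix : (b : W) • (⟨i, (1 : W)⟩ : Σ i, W ⧸ B i) = ⟨i, (1 : W)⟩ :=
    mem_stabilizer_coset.2 (by simp)
  set q := w * Φ b * w⁻¹ with hq
  have hqt : q ∈ ⨆ i ∈ t, B i := hw _ (le_iSup₂ (f := fun i (_ : i ∈ s) => B i) i hi b.2)
  have hq1 : q ≠ 1 := by simpa [hq] using hb
  have hqz : q • w • f ⟨i, (1 : W)⟩ = w • f ⟨i, (1 : W)⟩ := by
    rw [hq, ← mul_smul, inv_mul_cancel_right, mul_smul, ← hf, hbfix]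
  obtain ⟨i', x, hz⟩ : ∃ i', ∃ x : W ⧸ B i', w • f ⟨i, (1 : W)⟩ = ⟨i', x⟩ := ⟨_, _, rfl⟩
  obtain ⟨h, rfl⟩ := QuotientGroup.mk_surjective x
  rw [hz] at hqz
  -- The retraction to the subproduct `t` fixes `q`, so it moves the coset `h B i'` fixed by `q` to
  -- a coset that is fixed by `q` as well.
  have hmem := mem_stabilizer_coset.1 hqz
  have hproj : hB.proj t (h⁻¹ * q * h) = (hB.proj t h)⁻¹ * q * hB.proj t h := by
    rw [map_mul, map_mul, map_inv, hB.proj_eq_self_of_mem_iSup hqt]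
  have hi' : i' ∈ t := by
    by_contra hi'
    rw [hB.proj_of_notMem hi' hmem] at hproj
    apply hq1
    simpa [mul_assoc, inv_mul_eq_iff_eq_mul] using hproj.symm
  rw [hB.proj_of_mem hi' hmem] at hproj
  rw [hproj] at hmem
  have heq := hB.eq_of_smul_eq hq1 hqz (mem_stabilizer_coset.2 hmem)
  refine ⟨i', hi', hB.proj t h, hB.proj_mem_iSup t h, ?_⟩
  rw [heq, ← eq_inv_smul_iff] at hz
  have : (⟨i, g⟩ : Σ i, W ⧸ B i) = g • ⟨i, (1 : W)⟩ := by simp [Sigma.smul_mk]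
  rw [this, hf, hz, mul_assoc]
  rfl

/-- If an outer automorphism maps the conjugacy classes of proper subproducts of a decomposition
into nontrivial finite groups to one another, one of the subproducts being infinite, then it is
reducible. The colour `c i` tells to which subproduct the factor `B i` belongs, `none` standing for
none of them. -/
theorem Out.isReducible_of_subproducts [Finite ι] (hB : IsInternalFreeProduct B)
    (hfin : ∀ i, Finite (B i)) (hnt : ∀ i, Nontrivial (B i)) {φ : Out W} (c : ι → Option κ)
    (σ : κ → κ) (hσ : ∀ j, φ.MapsConjClass (⨆ i ∈ c ⁻¹' {some j}, B i)
      (⨆ i ∈ c ⁻¹' {some (σ j)}, B i))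
    (hproper : ∀ j, (⨆ i ∈ c ⁻¹' {some j}, B i) ≠ ⊤) {j₀ : κ}
    (hinf : Infinite (⨆ i ∈ c ⁻¹' {some j₀}, B i : Subgroup W)) : φ.IsReducible := by
  -- An infinite subproduct has more than one finite factor, which will give an edge.
  obtain ⟨i₁, hi₁, hb₁⟩ : ∃ i, c i = some j₀ ∧ ¬ (⨆ i ∈ c ⁻¹' {some j₀}, B i) ≤ B i := by
    by_contra! hcon
    by_cases hne : ∃ i, c i = some j₀
    · obtain ⟨i, hi⟩ := hne
      have := hfin i
      exact hinf.not_finite (Set.Finite.subset (Set.toFinite (B i : Set W)) (hcon i hi))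
    · push Not at hne
      have : c ⁻¹' {some j₀} = ∅ := Set.eq_empty_of_forall_notMem hne
      rw [this] at hinf
      simp only [Set.mem_empty_iff_false, iSup_false, iSup_bot] at hinf
      exact not_finite (⊥ : Subgroup W)
  have : Nonempty ι := ⟨i₁⟩
  obtain ⟨D, b, hD, hcb, hb, hDb⟩ := exists_isTree_star_fibers c
  obtain ⟨Φ, hΦ⟩ := QuotientGroup.mk_surjective φ
  obtain ⟨f, hfbij, hf⟩ := hB.exists_equivariant_bijective hfin hnt Φ
  let G : Orbigraph W := cosetOrbigraph hB hfin hD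
  have hcone : G.conePoints = Set.univ := by
    refine Set.eq_univ_of_forall fun x hx => ?_
    obtain ⟨w, hw, hwx⟩ := exists_ne_one_smul_eq hnt x
    exact hw ((Subgroup.eq_bot_iff_forall _).1 hx w hwx)
  let F : G.TopRep φ :=
    { Φ := Φ
      mk_eq := hΦ
      f := f
      equivariant := hf
      image_conePoints := by
        rw [hcone]
        exact Set.image_univ_of_surjective hfbij.surjective
      nondegenerate := fun x y h => hfbij.injective.ne (G.cover.ne_of_adj h) }
  -- The invariant subgraph consists of the edges that join factors of the same subproduct.
  let H : G.Subgraph :=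
    { preimage :=
        { verts := {x | c x.1 ≠ none}
          Adj := fun x y => (cosetGraph D B).Adj x y ∧ c x.1 = c y.1 ∧ c x.1 ≠ none
          adj_sub := fun h => h.1
          edge_vert := fun h => h.2.2
          symm := ⟨fun x y h => ⟨h.1.symm, h.2.1.symm, h.2.1 ▸ h.2.2⟩⟩ }
      smul_verts := fun w x hx => hx
      smul_adj := fun w x y h => ⟨cosetGraph_smul_adj w x y h.1, h.2⟩ }
  have hstar : ∀ i, c i ≠ none → b i ≠ i → ∀ g : W, H.preimage.Adj ⟨i, g⟩ ⟨b i, g⟩ :=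
    fun i hi hbi g => ⟨cosetGraph_adj_mk (hDb i hbi) g, (hcb i).symm, hi⟩
  have hcomp : ∀ j, ∀ g : W, ∀ i ∈ c ⁻¹' {some j}, ∀ i' ∈ c ⁻¹' {some j},
      H.preimage.spanningCoe.Reachable ⟨i, g⟩ ⟨i', g⟩ := by
    intro j g
    have h1 : ∀ i ∈ c ⁻¹' {some j}, H.preimage.spanningCoe.Reachable ⟨i, g⟩ ⟨b i, g⟩ := by
      intro i hi
      by_cases hbi : b i = i
      · rw [hbi]
        exact .rfl
      · exact SimpleGraph.Adj.reachable (hstar i (by rw [show c i = some j from hi]; simp) hbi g)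
    intro i hi i' hi'
    have h2 := h1 i' hi'
    rw [hb i' i (Eq.trans hi' (Eq.symm hi))] at h2
    exact (h1 i hi).trans h2.symm
  have himage : ∀ j, ∃ w : W, ∀ i ∈ c ⁻¹' {some j}, ∀ g : W, ∃ i' ∈ c ⁻¹' {some (σ j)},
      ∃ p ∈ ⨆ i ∈ c ⁻¹' {some (σ j)}, B i, f ⟨i, g⟩ = ⟨i', (Φ g * w⁻¹ * p : W)⟩ := by
    intro j
    obtain ⟨w, hw⟩ := hσ j Φ hΦ
    refine ⟨w, fun i hi g => hB.exists_image_eq hnt hf (fun p hp => ?_) hi g⟩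
    rw [← hw]
    exact ⟨Φ p, ⟨p, hp, rfl⟩, rfl⟩
  have hnontrivial : H.Nontrivial := by
    by_contra hcon
    have hbi : ∀ i, c i = some j₀ → b i = i := fun i hi => by
      by_contra hbi
      exact hcon ⟨_, _, hstar i (by simp [hi]) hbi 1⟩
    refine hb₁ (iSup₂_le fun i hi => le_of_eq ?_)
    rw [← hbi i hi, hb i i₁ (Eq.trans hi hi₁.symm), hbi i₁ hi₁]
  have hpropH : H.Proper := by
    intro htop
    have hadj : ∀ x y, G.cover.Adj x y → c x.1 = c y.1 ∧ c x.1 ≠ none := by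
      intro x y h
      have : H.preimage.Adj x y := by rw [htop]; exact h
      exact this.2
    -- All edges of `D` join factors of the same colour, and `D` is connected.
    have hconst : ∀ i, c i = some j₀ := by
      intro i
      obtain ⟨p⟩ := hD.connected i i₁
      induction p with
      | nil => exact hi₁
      | cons h p ih => exact ((hadj _ _ (cosetGraph_adj_mk h 1)).1).trans (ih hi₁ hb₁)
    refine hproper j₀ (eq_top_iff.2 fun g _ => ?_)
    induction g using hB.induction_on with
    | one => exact one_mem _
    | mem i b hb => exact le_iSup₂ (f := fun i (_ : i ∈ c ⁻¹' {some j₀}) => B i) i (hconst i) hb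
    | mul x y hx hy => exact mul_mem (hx trivial) (hy trivial)
  have hinvariant : F.Invariant H := by
    refine ⟨?_, ?_⟩
    · rintro ⟨i, x⟩ hx
      obtain ⟨g, rfl⟩ := QuotientGroup.mk_surjective x
      obtain ⟨j, hj⟩ := Option.ne_none_iff_exists'.1 hx
      obtain ⟨w, hw⟩ := himage j
      obtain ⟨i', hi', p, -, hfi⟩ := hw i hj g
      change c (f ⟨i, g⟩).1 ≠ none
      rw [hfi, show c i' = some (σ j) from hi']
      simp
    · rintro x y ⟨⟨-, g, hx, hy⟩, hc, hne⟩ p hp e he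
      obtain ⟨j, hj⟩ := Option.ne_none_iff_exists'.1 hne
      obtain ⟨w, hw⟩ := himage j
      obtain ⟨i', hi', q, hq, hfx⟩ := hw x.1 hj g
      obtain ⟨i'', hi'', q', hq', hfy⟩ := hw y.1 (hc.symm.trans hj) g
      rw [← hx] at hfx
      rw [← hy] at hfy
      have hreach : H.preimage.spanningCoe.Reachable (f x) (f y) := by
        have := reachable_of_mem_iSup (hcomp (σ j)) (mul_mem (inv_mem hq) hq')
          (Φ g * w⁻¹ * q) hi' hi''
        rw [mul_assoc _ q, mul_inv_cancel_left] at this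
        rw [hfx, hfy]
        exact this
      -- In a tree, the tight path is the path that runs inside the subgraph.
      obtain ⟨r, hr⟩ := hreach.exists_isPath
      have hpr : p = r.mapLe H.preimage.spanningCoe_le :=
        (G.isTree.existsUnique_path _ _).unique hp (hr.mapLe _)
      rw [hpr, SimpleGraph.Walk.edges_mapLe_eq_edges] at he
      simpa using r.edges_subset_edgeSet he
  have hforest : F.NoInvariantForest := by
    rintro ⟨K, ⟨⟨x, y, hxy⟩, hK⟩, -⟩
    have hx := K.preimage.edge_vert hxy
    have hy := K.preimage.edge_vert hxy.symm
    have hreach : K.preimage.spanningCoe.Reachable x y := SimpleGraph.Adj.reachable hxy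
    obtain ⟨z, -, hz⟩ := hK x hx
    -- The point to which the component contracts is fixed by the stabilizers of both `x` and `y`.
    have hzx : x = z := by
      obtain ⟨w, hw, hwx⟩ := exists_ne_one_smul_eq hnt x
      have hwx' : w • x = x := hwx
      exact hB.eq_of_smul_eq hw hwx (hz w (by rw [hwx']; exact ⟨hx, hx, .rfl⟩))
    have hzy : y = z := by
      obtain ⟨w, hw, hwy⟩ := exists_ne_one_smul_eq hnt y
      have hadj := K.smul_adj w _ _ hxy
      rw [show w • y = y from hwy] at hadj
      refine hB.eq_of_smul_eq hw hwy (hz w ⟨hx, K.smul_verts w x hx, hreach.trans ?_⟩)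
      exact SimpleGraph.Adj.reachable hadj.symm
    exact (K.preimage.adj_sub hxy).ne (hzx.trans hzy.symm)
  refine fun h => h G F (fun x hx => absurd (hcone ▸ Set.mem_univ x) hx) hforest
    ⟨H, hnontrivial, hpropH, hinvariant⟩

end Reducible

/-! ### Reducibility -/

/-- A family of subgroups that generate their free product, together with a complement of the
subgroup that they generate, is a decomposition of the group as a free product. -/
theorem GenerateFreeProduct.isInternalFreeProduct {W : Type u} [Group W] {ι : Type*}
    {H : ι → Subgroup W} (hfree : GenerateFreeProduct H) {K : Subgroup W}
    (hK : Function.Bijective (Monoid.Coprod.lift (⨆ i, H i).subtype K.subtype)) :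
    IsInternalFreeProduct fun o : Option ι => o.elim K H := by
  set P : Option ι → Subgroup W := fun o => o.elim K H
  let eW : Monoid.Coprod (⨆ i, H i : Subgroup W) K ≃* W := MulEquiv.ofBijective _ hK
  have hrange : (CoprodI.lift fun i => (H i).subtype).range = ⨆ i, H i := by
    simp [CoprodI.range_eq_iSup]
  let eS : CoprodI (fun i => H i) ≃* (⨆ i, H i : Subgroup W) :=
    (MonoidHom.ofInjective hfree).trans (MulEquiv.subgroupCongr hrange)
  let L : CoprodI (fun i => H i) →* CoprodI (fun o => P o) :=
    CoprodI.lift (M := fun i => H i) fun i => CoprodI.of (M := fun o => P o) (i := some i)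
  let g : Monoid.Coprod (⨆ i, H i : Subgroup W) K →* CoprodI (fun o => P o) :=
    Monoid.Coprod.lift (L.comp eS.symm.toMonoidHom)
      (CoprodI.of (M := fun o => P o) (i := none))
  -- `g` read through `eW` is inverse to the natural map from the free product.
  have hnone : ∀ p : K, g (eW.symm p) = CoprodI.of (M := fun o => P o) (i := none) p := by
    intro p
    have : eW (Monoid.Coprod.inr p) = p :=
      Monoid.Coprod.lift_apply_inr (⨆ i, H i).subtype K.subtype p
    rw [← this, MulEquiv.symm_apply_apply]
    exact Monoid.Coprod.lift_apply_inr _ _ p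
  have hsome : ∀ i (p : H i), g (eW.symm p) = CoprodI.of (M := fun o => P o) (i := some i) p := by
    intro i p
    let q : (⨆ i, H i : Subgroup W) := ⟨p, le_iSup H i p.2⟩
    have h1 : eW (Monoid.Coprod.inl q) = p :=
      Monoid.Coprod.lift_apply_inl (⨆ i, H i).subtype K.subtype q
    have h2 : eS (CoprodI.of (M := fun i => H i) p) = q :=
      Subtype.ext (CoprodI.lift_of (M := fun i => H i) (fun i => (H i).subtype) p)
    rw [← h1, MulEquiv.symm_apply_apply]
    refine (Monoid.Coprod.lift_apply_inl _ _ q).trans ?_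
    rw [MonoidHom.comp_apply, ← h2]
    change L (eS.symm (eS _)) = _
    rw [MulEquiv.symm_apply_apply]
    exact CoprodI.lift_of (M := fun i => H i)
      (fun i => CoprodI.of (M := fun o => P o) (i := some i)) p
  have hleft : (g.comp eW.symm.toMonoidHom).comp (CoprodI.lift fun o => (P o).subtype) =
      MonoidHom.id _ := by
    refine CoprodI.ext_hom _ _ fun o => MonoidHom.ext fun p => ?_
    simp only [MonoidHom.comp_apply, CoprodI.lift_of, MonoidHom.id_apply]
    cases o with
    | none => exact hnone p
    | some i => exact hsome i p
  refine ⟨Function.LeftInverse.injective (g := g.comp eW.symm.toMonoidHom)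
    (DFunLike.congr_fun hleft), ?_⟩
  rw [← MonoidHom.range_eq_top, CoprodI.range_eq_iSup]
  simp only [Subgroup.range_subtype]
  have hle : eW.toMonoidHom.range ≤ ⨆ o, P o := by
    change (Monoid.Coprod.lift (⨆ i, H i).subtype K.subtype).range ≤ _
    rw [Monoid.Coprod.range_lift]
    simp only [Subgroup.range_subtype]
    exact sup_le (iSup_le fun i => le_iSup P (some i)) (le_iSup P none)
  rw [eq_top_iff]
  refine le_trans (fun w _ => ?_) hle
  exact eW.surjective w

theorem mainTheorem10 {n : ℕ} (A : Fin n → Type u) [∀ i, Group (A i)] [∀ i, Finite (A i)]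
    [∀ i, Nontrivial (A i)]
    (φ : Out (Monoid.CoprodI A))
    {k : ℕ} [NeZero k] (H : Fin k → Subgroup (Monoid.CoprodI A))
    (hfactor : ∀ i, IsFreeFactor (H i)) (hproper : ∀ i, H i ≠ ⊤)
    (hinfinite : ∀ i, Infinite (H i))
    (hfree : GenerateFreeProduct H) (hsup : IsFreeFactor (⨆ i, H i))
    (hcyc : ∀ i : Fin k, Out.MapsConjClass φ (H i) (H (i + 1))) :
    Out.IsReducible φ := by
  obtain ⟨K, hK⟩ := hsup
  obtain ⟨c, B, hB, hAB, hPB⟩ := (hfree.isInternalFreeProduct hK).exists_refinement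
  have hHB : ∀ j, H j = ⨆ i ∈ c ⁻¹' {some j}, B i := fun j => hPB (some j)
  refine Out.isReducible_of_subproducts hB
    (fun i => (hAB i).elim fun e => Finite.of_equiv _ e.toEquiv)
    (fun i => (hAB i).elim fun e => e.symm.toEquiv.nontrivial) c (· + 1) (fun j => ?_)
    (fun j => hHB j ▸ hproper j) (j₀ := 0) (hHB 0 ▸ hinfinite 0)
  rw [← hHB, ← hHB]
  exact hcyc j
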